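/- Let $d\ge 2$ and let $n$ be such that the binomial coefficient $\binom{n-2}{d}$ is odd. Let $\mathcal P=\{P_1,\dots,P_n\}\subset\mathbb{RP}^d$ be a generic configuration of $n$ distinct points, i.e. for every $k\le d$ no $k+1$ of the points lie in a projective subspace of dimension $<k$. For $P\neq Q$ in $\mathcal P$ let $L_{P,Q}$ be the projective line through $P$ and $Q$, and for each connected component $C$ of $L_{P,Q}\setminus\{P,Q\}$ count the projective $(d-1)$-dimensional subspaces that are spanned by $d$ points of $\mathcal P\setminus\{P,Q\}$ and intersect $C$. Then, for all $P\ne Q$ in $\mathcal P$, exactly one component, denoted $I(P,Q)$, has a count congruent to $\binom{n-3}{d-1}$ modulo $2$. The complete graph $\Gamma$ on $n$ vertices can be immersed (mapped continuously and locally injectively) in $\mathbb{RP}^d$ so that its vertices go to $P_1,\dots,P_n$ and the open edge joining the vertices over $P$ and $Q$ is mapped bijectively onto $I(P,Q)$, for all $P\ne Q$ in $\mathcal P$. Every such immersion $\Gamma\to\mathbb{RP}^d$ is homologically trivial: for every base point the induced homomorphism $\pi_1(\Gamma)\to\pi_1(\mathbb{RP}^d)\cong\mathbb Z/2\mathbb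 Z$ is trivial. -/

import Mathlib

open scoped LinearAlgebra.Projectivization

namespace Orchard

/-- Real projective space of dimension `d`: the lines through `0` in `ℝ ^ (d + 1)`. -/
abbrev RP (d : ℕ) : Type := ℙ ℝ (Fin (d + 1) → ℝ)

/-- The quotient topology, from the topology of `ℝ ^ (d + 1) ∖ {0}`. -/
instance (d : ℕ) : TopologicalSpace (RP d) :=
  inferInstanceAs (TopologicalSpace (Quotient (projectivizationSetoid ℝ (Fin (d + 1) → ℝ))))

/-- Projective (linear) subspaces of `RP d`. -/
abbrev ProjSubspace (d : ℕ) : Type := Projectivization.Subspace ℝ (Fin (d + 1) → ℝ)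

/-- The configuration of the `n` points `P i` is generic: the points are distinct, and no
`m ≤ d + 1` of them lie in a projective subspace of dimension less than `m - 1`, that is, in one
that comes from a linear subspace of dimension less than `m`. -/
def IsGeneric {n d : ℕ} (P : Fin n → RP d) : Prop :=
  Function.Injective P ∧
    ∀ s : Finset (Fin n), s.card ≤ d + 1 → ∀ W : ProjSubspace d, (∀ i ∈ s, P i ∈ W) →
      s.card ≤ Module.finrank ℝ (Projectivization.Subspace.submodule W)

/-- The projective line through `P i` and `P j`, with these two points removed. -/
def puncturedLine {n d : ℕ} (P : Fin n → RP d) (i j : Fin n) : Set (RP d) :=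
  (Projectivization.Subspace.span {P i, P j} : Set (RP d)) \ {P i, P j}

/-- `C` is one of the connected components of the subset `A` of a topological space. -/
def IsComponentOf {X : Type*} [TopologicalSpace X] (C A : Set X) : Prop :=
  ∃ x ∈ A, C = connectedComponentIn A x

/-- The projective subspaces spanned by `d` points of the configuration other than
`P i` and `P j`. For a generic configuration they have dimension `d - 1`. -/
def spannedHyperplanes {n d : ℕ} (P : Fin n → RP d) (i j : Fin n) : Set (ProjSubspace d) :=
  {H | ∃ s : Finset (Fin n), s.card = d ∧ i ∉ s ∧ j ∉ s ∧
    H = Projectivization.Subspace.span (P '' s)}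

/-- The number of these hyperplanes that intersect the set `C`. -/
noncomputable def crossingNumber {n d : ℕ} (P : Fin n → RP d) (i j : Fin n)
    (C : Set (RP d)) : ℕ :=
  Set.ncard {H ∈ spannedHyperplanes P i j | ((H : Set (RP d)) ∩ C).Nonempty}

/-- `C` is a connected component of the punctured line through `P i` and `P j` whose number of
crossings with spanned hyperplanes has the parity of the binomial coefficient
`n - 3` over `d - 1`. -/
def IsOrchardArc {n d : ℕ} (P : Fin n → RP d) (i j : Fin n) (C : Set (RP d)) : Prop :=
  IsComponentOf C (puncturedLine P i j) ∧
    crossingNumber P i j C ≡ (n - 3).choose (d - 1) [MOD 2]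

/-- The complete graph on `n` vertices as a topological space: the geometric realization of the
`1`-skeleton of the simplex with `n` vertices, in barycentric coordinates. -/
def CompleteGraphSpace (n : ℕ) : Type :=
  {x : Fin n → ℝ // x ∈ stdSimplex ℝ (Fin n) ∧ (Function.support x).ncard ≤ 2}

instance (n : ℕ) : TopologicalSpace (CompleteGraphSpace n) :=
  inferInstanceAs (TopologicalSpace
    {x : Fin n → ℝ // x ∈ stdSimplex ℝ (Fin n) ∧ (Function.support x).ncard ≤ 2})

/-- The vertex with index `i`. -/
def vertex {n : ℕ} (i : Fin n) : CompleteGraphSpace n :=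
  ⟨Pi.single i 1, single_mem_stdSimplex ℝ i,
    ((Set.ncard_le_ncard Pi.support_single_subset).trans (Set.ncard_singleton i).le).trans
      one_le_two⟩

/-- The open edge between two different vertices. -/
def openEdge {n : ℕ} (i j : Fin n) : Set (CompleteGraphSpace n) :=
  {x | 0 < x.1 i ∧ 0 < x.1 j}

/-- The continuous map `f` immerses (injectively near every point) the complete graph into `RP d`,
with vertices the points `P i` and with edges the components selected by the parity condition. -/
structure IsOrchardImmersion {n d : ℕ} (P : Fin n → RP d)
    (f : C(CompleteGraphSpace n, RP d)) : Prop where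
  map_vertex : ∀ i, f (vertex i) = P i
  map_edge : ∀ i j, i ≠ j → ∃ C, IsOrchardArc P i j C ∧ Set.BijOn f (openEdge i j) C
  locally_injective : ∀ x, ∃ U ∈ nhds x, Set.InjOn f U

/-- A continuous map is homologically trivial if the homomorphisms that it induces between
fundamental groups are trivial. -/
def HomologicallyTrivial {G X : Type*} [TopologicalSpace G] [TopologicalSpace X]
    (f : C(G, X)) : Prop :=
  ∀ x : G, FundamentalGroup.map f x = 1

end Orchard

open scoped LinearAlgebra.Projectivization

namespace Orchard

open Projectivization Module

/-! Choose vectors representing the points and, for each spanned hyperplane, a functional cutting it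
out. The two components of a punctured line are the arcs of positive combinations of `v i` with `v
j` and with `-v j`. A hyperplane avoiding both points meets exactly one of them, decided by the
signs of its functional at the ends. So the two counts add up to the odd number `(n - 2).choose d`
and have different parities.

The key is `separatingCount_triangle`: modulo 2, the counts along a triangle sum to `(n - 3).choose
(d - 1)`. Hyperplanes through none of the vertices contribute evenly, and by `triple_sign` each set
of `d - 1` further points contributes 1. Flip signs so that all edges at one base vertex have the
desired parity; the triangle relation then gives it to every other edge. Hence all selected
components are simultaneously the arcs of positive combinations of suitable representatives `w i`.

Existence of an immersion follows by extending `w` linearly over the graph and projectivizing.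
Conversely, every orchard immersion lifts to nonzero vectors, normalized on each edge as `s • w i +
t • w j` with `s + t = 1`. The lift stays in finitely many planes, so it misses a ray in a direction
outside all of them. The complement of that closed ray is contractible, and the immersion factors
through it. -/

/-- The vectors `v i` represent the points `P i`. -/
def Represents {n d : ℕ} (v : Fin n → Fin (d + 1) → ℝ) (P : Fin n → RP d) : Prop :=
  ∀ i, ∃ h : v i ≠ 0, mk ℝ (v i) h = P i

/-- Each functional `φ s`, for `s` of size `d`, has as kernel the hyperplane spanned by the points
with indices in `s`. -/
def IsHyperplaneSystem {n d : ℕ} (P : Fin n → RP d)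
    (φ : Finset (Fin n) → Dual ℝ (Fin (d + 1) → ℝ)) : Prop :=
  ∀ s : Finset (Fin n), s.card = d → ∀ x,
    φ s x = 0 ↔ x ∈ Projectivization.Subspace.submodule (Projectivization.Subspace.span (P '' s))

/-! ### Generic points, spanned hyperplanes and their functionals -/

section GeneralPosition

variable {n d : ℕ} {P : Fin n → RP d} {v : Fin n → Fin (d + 1) → ℝ}
  {φ : Finset (Fin n) → Dual ℝ (Fin (d + 1) → ℝ)}

theorem Represents.mem_iff (hv : Represents v P) (i : Fin n) (W : ProjSubspace d) :
    P i ∈ W ↔ v i ∈ Projectivization.Subspace.submodule W := by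
  obtain ⟨h, hi⟩ := hv i
  rw [← hi, Projectivization.Subspace.mem_submodule_iff]

theorem exists_represents (P : Fin n → RP d) : ∃ v, Represents v P :=
  ⟨fun i => (P i).rep, fun i => ⟨(P i).rep_nonzero, (P i).mk_rep⟩⟩

theorem Represents.submodule_span (hv : Represents v P) (s : Set (Fin n)) :
    Projectivization.Subspace.submodule (Projectivization.Subspace.span (P '' s)) =
      Submodule.span ℝ (v '' s) := by
  apply le_antisymm
  · rw [← OrderIso.le_symm_apply, Projectivization.Subspace.span_le_subspace_iff]
    rintro _ ⟨i, hi, rfl⟩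
    rw [SetLike.mem_coe, hv.mem_iff, OrderIso.apply_symm_apply]
    exact Submodule.subset_span ⟨i, hi, rfl⟩
  · rw [Submodule.span_le]
    rintro _ ⟨i, hi, rfl⟩
    rw [SetLike.mem_coe, ← hv.mem_iff]
    exact Projectivization.Subspace.subset_span _ ⟨i, hi, rfl⟩

theorem IsGeneric.card_le (hP : IsGeneric P) {s : Finset (Fin n)} (hs : s.card ≤ d + 1) :
    s.card ≤ finrank ℝ (Projectivization.Subspace.submodule
      (Projectivization.Subspace.span (P '' s))) :=
  hP.2 s hs _ fun i hi => Projectivization.Subspace.subset_span _ ⟨i, hi, rfl⟩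

theorem IsGeneric.linearIndepOn (hP : IsGeneric P) (hv : Represents v P) {s : Finset (Fin n)}
    (hs : s.card ≤ d + 1) : LinearIndepOn ℝ v (s : Set (Fin n)) := by
  have h := hP.card_le hs
  rw [hv.submodule_span] at h
  change LinearIndependent ℝ (fun x : (s : Set (Fin n)) => v x)
  rw [linearIndependent_iff_card_le_finrank_span]
  have e : Set.range (fun x : (s : Set (Fin n)) => v x) = v '' s := by
    ext; simp
  rw [e]
  simpa [Set.finrank] using h

theorem IsGeneric.linearIndependent_pair (hP : IsGeneric P) (hv : Represents v P) (hd : 1 ≤ d)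
    {i j : Fin n} (hij : i ≠ j) : LinearIndependent ℝ ![v i, v j] := by
  have h := hP.linearIndepOn hv (s := {i, j})
    (by rw [Finset.card_pair hij]; omega)
  rw [linearIndepOn_finset_iff] at h
  rw [LinearIndependent.pair_iff]
  intro a b hab
  have := h (fun k => if k = i then a else b)
    (by rw [Finset.sum_pair hij]; simpa [hij.symm] using hab)
  have h1 := this i (by simp)
  have h2 := this j (by simp)
  simp only [if_true, hij.symm, if_false] at h1 h2
  exact ⟨h1, h2⟩

theorem IsGeneric.finrank_eq (hP : IsGeneric P) {s : Finset (Fin n)} (hs : s.card = d) :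
    finrank ℝ (Projectivization.Subspace.submodule
      (Projectivization.Subspace.span (P '' s))) = d := by
  obtain ⟨v, hv⟩ := exists_represents P
  apply le_antisymm
  · rw [hv.submodule_span, ← Finset.coe_image]
    exact (finrank_span_finset_le_card _).trans (Finset.card_image_le.trans hs.le)
  · simpa only [hs] using hP.card_le (s := s) (by omega)

theorem IsGeneric.mem_span_iff (hP : IsGeneric P) {s : Finset (Fin n)} (hs : s.card = d)
    (i : Fin n) : P i ∈ Projectivization.Subspace.span (P '' s) ↔ i ∈ s := by
  refine ⟨fun h => ?_, fun h => Projectivization.Subspace.subset_span _ ⟨i, h, rfl⟩⟩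
  by_contra hi
  have := hP.2 (insert i s) (by rw [Finset.card_insert_of_notMem hi, hs])
    (Projectivization.Subspace.span (P '' s)) (by
      intro k hk
      rcases Finset.mem_insert.1 hk with rfl | hk
      · exact h
      · exact Projectivization.Subspace.subset_span _ ⟨k, hk, rfl⟩)
  rw [hP.finrank_eq hs, Finset.card_insert_of_notMem hi, hs] at this
  omega

theorem IsGeneric.exists_isHyperplaneSystem (hP : IsGeneric P) :
    ∃ φ, IsHyperplaneSystem P φ := by
  have key : ∀ s : Finset (Fin n), ∃ f : Dual ℝ (Fin (d + 1) → ℝ), s.card = d → ∀ x,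
      f x = 0 ↔ x ∈ Projectivization.Subspace.submodule
        (Projectivization.Subspace.span (P '' s)) := by
    intro s
    by_cases hs : s.card = d
    swap
    -- The value is arbitrary for index sets of the wrong size.
    · exact ⟨0, fun h => absurd h hs⟩
    have hr := hP.finrank_eq hs
    obtain ⟨f, hf, hle⟩ := Submodule.exists_le_ker_of_lt_top
      (Projectivization.Subspace.submodule (Projectivization.Subspace.span (P '' s)))
      (lt_top_iff_ne_top.2 fun h => by
        rw [h, finrank_top, Module.finrank_fin_fun] at hr; omega)
    have hk := Module.Dual.finrank_ker_add_one_of_ne_zero hf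
    rw [Module.finrank_fin_fun] at hk
    have := Submodule.eq_of_le_of_finrank_eq hle (by omega)
    exact ⟨f, fun _ x => by rw [this]; rfl⟩
  choose φ hφ using key
  exact ⟨φ, hφ⟩

/-- By genericity a spanned hyperplane contains no further point of the configuration, so the signs
used in the counts are never zero. -/
theorem IsHyperplaneSystem.apply_eq_zero (hφ : IsHyperplaneSystem P φ) (hP : IsGeneric P)
    (hv : Represents v P) {s : Finset (Fin n)} (hs : s.card = d) (i : Fin n) :
    φ s (v i) = 0 ↔ i ∈ s := by
  rw [hφ s hs, ← hv.mem_iff, hP.mem_span_iff hs]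

/-- Functionals that vanish on a spanned hyperplane are unique up to scalars. -/
theorem IsHyperplaneSystem.exists_eq_smul (hφ : IsHyperplaneSystem P φ)
    (hv : Represents v P) {s : Finset (Fin n)} (hs : s.card = d)
    (ψ : Dual ℝ (Fin (d + 1) → ℝ)) (hψ : ∀ i ∈ s, ψ (v i) = 0) : ∃ c : ℝ, ψ = c • φ s := by
  have := mem_span_of_iInf_ker_le_ker (L := fun _ : Unit => φ s) (K := ψ) (by
    intro x hx
    rw [iInf_const, LinearMap.mem_ker, hφ s hs, hv.submodule_span] at hx
    refine (Submodule.span_le (p := LinearMap.ker ψ)).2 ?_ hx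
    rintro _ ⟨i, hi, rfl⟩
    exact hψ i hi)
  rw [Set.range_const, Submodule.mem_span_singleton] at this
  obtain ⟨c, hc⟩ := this
  exact ⟨c, hc.symm⟩

/-- The hyperplanes through a codimension two flat and one of three points separate the other two
points, in representatives, an odd number of times. -/
theorem IsHyperplaneSystem.triple_sign (hφ : IsHyperplaneSystem P φ) (hP : IsGeneric P)
    (hv : Represents v P) {t : Finset (Fin n)} (ht : t.card + 1 = d) {i j k : Fin n}
    (hi : i ∉ t) (hj : j ∉ t) (hk : k ∉ t) (hij : i ≠ j) (hjk : j ≠ k) (hik : i ≠ k) :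
    (φ (insert k t) (v i) * φ (insert k t) (v j)) * (φ (insert i t) (v j) * φ (insert i t) (v k)) *
      (φ (insert j t) (v i) * φ (insert j t) (v k)) < 0 := by
  have ci : (insert i t).card = d := by rw [Finset.card_insert_of_notMem hi, ht]
  have cj : (insert j t).card = d := by rw [Finset.card_insert_of_notMem hj, ht]
  have ck : (insert k t).card = d := by rw [Finset.card_insert_of_notMem hk, ht]
  have zi := hφ.apply_eq_zero hP hv ci
  have zj := hφ.apply_eq_zero hP hv cj
  -- This combination is chosen to vanish at `v k` as well as on `t`, so it is a multiple of `φ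
  -- (insert k t)`. Multiplying its values at `v i` and `v j` gives the sign relation.
  obtain ⟨c, hc⟩ := hφ.exists_eq_smul hv ck
    (φ (insert j t) (v k) • φ (insert i t) - φ (insert i t) (v k) • φ (insert j t)) (by
      intro l hl
      rcases Finset.mem_insert.1 hl with rfl | hl
      · simp only [LinearMap.sub_apply, LinearMap.smul_apply, smul_eq_mul]; ring
      · simp [(zi l).2 (Finset.mem_insert_of_mem hl), (zj l).2 (Finset.mem_insert_of_mem hl)])
  have e1 := LinearMap.congr_fun hc (v i)
  have e2 := LinearMap.congr_fun hc (v j)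
  simp only [LinearMap.sub_apply, LinearMap.smul_apply, smul_eq_mul,
    (zi i).2 (Finset.mem_insert_self _ _), (zj j).2 (Finset.mem_insert_self _ _)] at e1 e2
  have h1 : φ (insert i t) (v j) ≠ 0 := by
    rw [Ne, zi, Finset.mem_insert, not_or]; exact ⟨hij.symm, hj⟩
  have h2 : φ (insert i t) (v k) ≠ 0 := by
    rw [Ne, zi, Finset.mem_insert, not_or]; exact ⟨hik.symm, hk⟩
  have h3 : φ (insert j t) (v i) ≠ 0 := by
    rw [Ne, zj, Finset.mem_insert, not_or]; exact ⟨hij, hi⟩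
  have h4 : φ (insert j t) (v k) ≠ 0 := by
    rw [Ne, zj, Finset.mem_insert, not_or]; exact ⟨hjk.symm, hk⟩
  generalize φ (insert i t) (v j) = a at *
  generalize φ (insert i t) (v k) = b at *
  generalize φ (insert j t) (v i) = x at *
  generalize φ (insert j t) (v k) = y at *
  generalize φ (insert k t) (v i) = p at *
  generalize φ (insert k t) (v j) = q at *
  have hpos : 0 < (a * b * x * y) ^ 2 := by positivity
  have e : c ^ 2 * ((p * q) * (a * b) * (x * y)) = -(a * b * x * y) ^ 2 := by
    linear_combination (-(c * q) * (a * b) * (x * y)) * e1 + (b * x) * (a * b) * (x * y) * e2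
  by_contra hcon
  have := mul_nonneg (sq_nonneg c) (not_lt.1 hcon)
  linarith

end GeneralPosition

/-! ### Parity of separating counts and choice of signs -/

section Parity

open Finset

variable {n d : ℕ} {P : Fin n → RP d} {v : Fin n → Fin (d + 1) → ℝ}
  {φ : Finset (Fin n) → Dual ℝ (Fin (d + 1) → ℝ)}

/-- The sets of `d` indices other than `i` and `j`. -/
def avoidingSets (n d : ℕ) (i j : Fin n) : Finset (Finset (Fin n)) :=
  powersetCard d ({i, j}ᶜ : Finset (Fin n))

theorem mem_avoidingSets {i j : Fin n} {s : Finset (Fin n)} :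
    s ∈ avoidingSets n d i j ↔ s.card = d ∧ i ∉ s ∧ j ∉ s := by
  rw [avoidingSets, mem_powersetCard, and_comm, subset_compl_comm]
  simp [insert_subset_iff]

theorem card_avoidingSets {i j : Fin n} (hij : i ≠ j) :
    (avoidingSets n d i j).card = (n - 2).choose d := by
  rw [avoidingSets, card_powersetCard, card_compl, card_pair hij, Fintype.card_fin]

/-- The number of spanned hyperplanes that separate the vectors `a` and `b`. -/
noncomputable def separatingCount (φ : Finset (Fin n) → Dual ℝ (Fin (d + 1) → ℝ)) (i j : Fin n)
    (a b : Fin (d + 1) → ℝ) : ℕ :=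
  ((avoidingSets n d i j).filter fun s => φ s a * φ s b < 0).card

theorem separatingCount_comm (i j : Fin n) (a b : Fin (d + 1) → ℝ) :
    separatingCount φ i j a b = separatingCount φ j i b a := by
  simp only [separatingCount, avoidingSets, mul_comm, pair_comm]

/-- Negating one end reverses every sign comparison, and none of the products is zero. -/
theorem separatingCount_add_neg (hφ : IsHyperplaneSystem P φ) (hP : IsGeneric P)
    (hv : Represents v P) {i j : Fin n} (hij : i ≠ j) :
    separatingCount φ i j (v i) (v j) + separatingCount φ i j (v i) (-v j) =
      (n - 2).choose d := by
  classical
  rw [← card_avoidingSets hij, separatingCount, separatingCount,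
    ← card_filter_add_card_filter_not (s := avoidingSets n d i j)
      (fun s => φ s (v i) * φ s (v j) < 0)]
  congr 2
  apply filter_congr
  intro s hs
  obtain ⟨hs, hi, hj⟩ := mem_avoidingSets.1 hs
  rw [← hφ.apply_eq_zero hP hv hs] at hi hj
  have : φ s (v i) * φ s (v j) ≠ 0 := mul_ne_zero hi hj
  rw [map_neg, mul_neg, neg_lt_zero, not_lt, le_iff_lt_or_eq]
  simp [this.symm]

/-- Splits the index sets according to whether they contain `k`, so that the three counts of a
triangle can be compared over common sums. -/
theorem separatingCount_cast (i j k : Fin n) (hjk : j ≠ k) (hik : i ≠ k)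
    (hd : 1 ≤ d) (a b : Fin (d + 1) → ℝ) :
    (separatingCount φ i j a b : ZMod 2) =
      (∑ s ∈ powersetCard d ({i, j, k}ᶜ : Finset (Fin n)), if φ s a * φ s b < 0 then 1 else 0) +
      ∑ t ∈ powersetCard (d - 1) ({i, j, k}ᶜ : Finset (Fin n)),
        if φ (insert k t) a * φ (insert k t) b < 0 then 1 else 0 := by
  classical
  obtain ⟨d, rfl⟩ : ∃ e, d = e + 1 := ⟨d - 1, by omega⟩
  have hk : k ∉ ({i, j, k}ᶜ : Finset (Fin n)) := by simp
  have e : ({i, j}ᶜ : Finset (Fin n)) = insert k {i, j, k}ᶜ := by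
    ext l; by_cases h : l = k
    · subst h; simp [hjk.symm, hik.symm]
    · simp [h]
  have hnot : ∀ t ∈ powersetCard d ({i, j, k}ᶜ : Finset (Fin n)), k ∉ t := fun t ht hkt =>
    hk ((mem_powersetCard.1 ht).1 hkt)
  rw [separatingCount, card_filter, avoidingSets, e, powersetCard_succ_insert hk, sum_union,
    sum_image]
  · push_cast; simp
  · intro s hs t ht hst
    rw [← erase_insert (hnot s hs), hst, erase_insert (hnot t ht)]
  · rw [disjoint_left]
    intro s hs hs'
    obtain ⟨t, -, rfl⟩ := mem_image.1 hs'
    exact hk ((mem_powersetCard.1 hs).1 (mem_insert_self _ _))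

theorem three_indicators_of_ne_zero {x y z : ℝ} (hx : x ≠ 0) (hy : y ≠ 0) (hz : z ≠ 0) :
    ((if x * y < 0 then 1 else 0) + (if y * z < 0 then 1 else 0) +
      (if x * z < 0 then 1 else 0) : ZMod 2) = 0 := by
  rcases hx.lt_or_gt with hx | hx <;> rcases hy.lt_or_gt with hy | hy <;>
    rcases hz.lt_or_gt with hz | hz <;>
    simp [mul_neg_iff, hx, hy, hz, not_lt.2 hx.le, not_lt.2 hy.le,
      not_lt.2 hz.le] <;> decide

theorem three_indicators_of_mul_neg {x y z : ℝ} (h : x * y * z < 0) :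
    ((if x < 0 then 1 else 0) + (if y < 0 then 1 else 0) + (if z < 0 then 1 else 0) : ZMod 2) =
      1 := by
  have hx : x ≠ 0 := by rintro rfl; simp at h
  have hy : y ≠ 0 := by rintro rfl; simp at h
  have hz : z ≠ 0 := by rintro rfl; simp at h
  rcases hx.lt_or_gt with hx | hx <;> rcases hy.lt_or_gt with hy | hy <;>
    rcases hz.lt_or_gt with hz | hz <;>
    simp [mul_neg_iff, mul_pos_iff, hx, hy, hz, not_lt.2 hx.le, not_lt.2 hy.le,
      not_lt.2 hz.le] at h ⊢; decide

/-- The parities of the separating counts of a triangle add up to a binomial coefficient. -/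
theorem separatingCount_triangle (hφ : IsHyperplaneSystem P φ) (hP : IsGeneric P)
    (hv : Represents v P) (hd : 1 ≤ d) {i j k : Fin n} (hij : i ≠ j) (hjk : j ≠ k) (hik : i ≠ k) :
    (separatingCount φ i j (v i) (v j) + separatingCount φ j k (v j) (v k) +
      separatingCount φ i k (v i) (v k) : ZMod 2) = (n - 3).choose (d - 1) := by
  have e1 : ({j, k, i} : Finset (Fin n)) = {i, j, k} := by ext; simp; tauto
  have e2 : ({i, k, j} : Finset (Fin n)) = {i, j, k} := by ext; simp; tauto
  rw [separatingCount_cast i j k hjk hik hd, separatingCount_cast j k i hik.symm hij.symm hd,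
    separatingCount_cast i k j hjk.symm hij hd, e1, e2]
  have hmem : ∀ m, ∀ s ∈ powersetCard m ({i, j, k}ᶜ : Finset (Fin n)),
      s.card = m ∧ i ∉ s ∧ j ∉ s ∧ k ∉ s := by
    intro m s hs
    obtain ⟨h1, h2⟩ := mem_powersetCard.1 hs
    refine ⟨h2, ?_, ?_, ?_⟩ <;> intro h <;> simpa using h1 h
  -- A hyperplane through none of the three vertices separates zero or two of the pairs.
  have z : (∑ s ∈ powersetCard d ({i, j, k}ᶜ : Finset (Fin n)),
        if φ s (v i) * φ s (v j) < 0 then (1 : ZMod 2) else 0) +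
      (∑ s ∈ powersetCard d ({i, j, k}ᶜ : Finset (Fin n)),
        if φ s (v j) * φ s (v k) < 0 then (1 : ZMod 2) else 0) +
      (∑ s ∈ powersetCard d ({i, j, k}ᶜ : Finset (Fin n)),
        if φ s (v i) * φ s (v k) < 0 then (1 : ZMod 2) else 0) = 0 := by
    rw [← sum_add_distrib, ← sum_add_distrib]
    refine sum_eq_zero fun s hs => ?_
    obtain ⟨hs, hi, hj, hk⟩ := hmem _ s hs
    rw [← hφ.apply_eq_zero hP hv hs] at hi hj hk
    exact three_indicators_of_ne_zero hi hj hk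
  have o : (∑ t ∈ powersetCard (d - 1) ({i, j, k}ᶜ : Finset (Fin n)),
        if φ (insert k t) (v i) * φ (insert k t) (v j) < 0 then (1 : ZMod 2) else 0) +
      (∑ t ∈ powersetCard (d - 1) ({i, j, k}ᶜ : Finset (Fin n)),
        if φ (insert i t) (v j) * φ (insert i t) (v k) < 0 then (1 : ZMod 2) else 0) +
      (∑ t ∈ powersetCard (d - 1) ({i, j, k}ᶜ : Finset (Fin n)),
        if φ (insert j t) (v i) * φ (insert j t) (v k) < 0 then (1 : ZMod 2) else 0) =
      (n - 3).choose (d - 1) := by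
    rw [← sum_add_distrib, ← sum_add_distrib]
    have hc : ({i, j, k} : Finset (Fin n)).card = 3 := card_eq_three.2 ⟨i, j, k, hij, hik, hjk, rfl⟩
    rw [sum_congr rfl (g := fun _ => (1 : ZMod 2)), sum_const, card_powersetCard, card_compl, hc,
      Fintype.card_fin, nsmul_one]
    intro t ht
    obtain ⟨ht, hi, hj, hk⟩ := hmem _ t ht
    exact three_indicators_of_mul_neg
      (hφ.triple_sign hP hv (by omega) hi hj hk hij hjk hik)
  linear_combination z + o

theorem Represents.neg_of (hv : Represents v P) (q : Fin n → Prop) [DecidablePred q] :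
    Represents (fun i => if q i then v i else -v i) P := by
  intro i
  obtain ⟨h, hi⟩ := hv i
  by_cases hq : q i
  · simp only [hq, if_true]; exact ⟨h, hi⟩
  · simp only [hq, if_false]
    refine ⟨neg_ne_zero.2 h, ?_⟩
    rw [← hi, mk_eq_mk_iff']
    exact ⟨-1, by simp⟩

/-- Representatives can be chosen such that all separating counts have the parity of the same
binomial coefficient. -/
theorem exists_represents_separatingCount (hφ : IsHyperplaneSystem P φ) (hP : IsGeneric P)
    (hd : 1 ≤ d) (hodd : Odd ((n - 2).choose d)) :
    ∃ w, Represents w P ∧ ∀ i j, i ≠ j →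
      (separatingCount φ i j (w i) (w j) : ZMod 2) = (n - 3).choose (d - 1) := by
  classical
  obtain ⟨v, hv⟩ := exists_represents P
  rcases Nat.eq_zero_or_pos n with rfl | hn
  · exact ⟨v, hv, fun i => i.elim0⟩
  let o : Fin n := ⟨0, hn⟩
  -- The vertices that keep their sign. For the others, flipping changes the parity of the edge to
  -- `o`, since the two counts have an odd sum.
  let q : Fin n → Prop := fun i => i = o ∨
    (separatingCount φ o i (v o) (v i) : ZMod 2) = (n - 3).choose (d - 1)
  refine ⟨fun i => if q i then v i else -v i, hv.neg_of q, ?_⟩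
  have hw := hv.neg_of q
  set w : Fin n → Fin (d + 1) → ℝ := fun i => if q i then v i else -v i with hwdef
  have hwo : w o = v o := by simp [hwdef, q]
  have base : ∀ i, o ≠ i →
      (separatingCount φ o i (w o) (w i) : ZMod 2) = (n - 3).choose (d - 1) := by
    intro i hi
    rw [hwo]
    by_cases hq : q i
    · have : w i = v i := by simp only [hwdef, hq, if_true]
      rw [this]
      exact hq.resolve_left hi.symm
    · have : w i = -v i := by simp only [hwdef, hq, if_false]
      rw [this]
      have h1 := congrArg (Nat.cast (R := ZMod 2)) (separatingCount_add_neg hφ hP hv hi)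
      rw [ZMod.natCast_eq_one_iff_odd.2 hodd] at h1
      push_cast at h1
      have h2 : (separatingCount φ o i (v o) (v i) : ZMod 2) ≠ (n - 3).choose (d - 1) :=
        fun h => hq (Or.inr h)
      have aux : ∀ x y z : ZMod 2, x + y = 1 → x ≠ z → y = z := by decide
      exact aux _ _ _ h1 h2
  intro i j hij
  by_cases hi : o = i
  · subst hi; exact base j hij
  by_cases hj : o = j
  · subst hj; rw [separatingCount_comm]; exact base i hij.symm
  have h := separatingCount_triangle hφ hP hw hd hi hij hj
  rw [base i hi, base j hj] at h
  have aux : ∀ x z : ZMod 2, z + x + z = z → x = z := by decide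
  exact aux _ _ h

end Parity

/-! ### Projective segments, their components and lifts -/

section Arcs

variable {d : ℕ} {a b : Fin (d + 1) → ℝ}

theorem isQuotientMap_mk' :
    Topology.IsQuotientMap (mk' ℝ : {v : Fin (d + 1) → ℝ // v ≠ 0} → RP d) :=
  isQuotientMap_quotient_mk'

theorem continuous_mk' : Continuous (mk' ℝ : {v : Fin (d + 1) → ℝ // v ≠ 0} → RP d) :=
  isQuotientMap_mk'.continuous

/-- The open projective segment of the points represented by positive combinations. -/
def arc (a b : Fin (d + 1) → ℝ) : Set (RP d) :=
  {p | ∃ s t : ℝ, 0 < s ∧ 0 < t ∧ ∃ h : s • a + t • b ≠ 0, mk ℝ (s • a + t • b) h = p}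

/-- Rescaling a representative multiplies both coefficients by the same scalar, so only the sign of
their product is meaningful. -/
theorem mk_mem_arc_iff {u : Fin (d + 1) → ℝ} (hu : u ≠ 0) :
    mk ℝ u hu ∈ arc a b ↔ ∃ s t : ℝ, 0 < s * t ∧ u = s • a + t • b := by
  constructor
  · rintro ⟨s, t, hs, ht, h, e⟩
    rw [mk_eq_mk_iff'] at e
    obtain ⟨c, hc⟩ := e
    have hc0 : c ≠ 0 := by rintro rfl; simp at hc; exact h hc.symm
    refine ⟨c⁻¹ * s, c⁻¹ * t, ?_, ?_⟩
    · have : 0 < (c⁻¹) ^ 2 * (s * t) := by positivity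
      linarith
    · rw [mul_smul, mul_smul, ← smul_add, ← hc, smul_smul, inv_mul_cancel₀ hc0, one_smul]
  · rintro ⟨s, t, hst, rfl⟩
    rcases pos_and_pos_or_neg_and_neg_of_mul_pos hst with ⟨hs, ht⟩ | ⟨hs, ht⟩
    · exact ⟨s, t, hs, ht, hu, rfl⟩
    · have e : (-s) • a + (-t) • b = -(s • a + t • b) := by module
      refine ⟨-s, -t, neg_pos.2 hs, neg_pos.2 ht, by rw [e]; exact neg_ne_zero.2 hu, ?_⟩
      rw [mk_eq_mk_iff']
      exact ⟨-1, by module⟩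

theorem mk_mem_arc_neg_iff {u : Fin (d + 1) → ℝ} (hu : u ≠ 0) :
    mk ℝ u hu ∈ arc a (-b) ↔ ∃ s t : ℝ, s * t < 0 ∧ u = s • a + t • b := by
  rw [mk_mem_arc_iff]
  constructor
  · rintro ⟨s, t, h, e⟩
    exact ⟨s, -t, by linarith, by rw [e]; module⟩
  · rintro ⟨s, t, h, e⟩
    exact ⟨s, -t, by linarith, by rw [e]; module⟩

theorem smul_add_smul_ne_zero (hab : LinearIndependent ℝ ![a, b]) {s t : ℝ}
    (h : s ≠ 0 ∨ t ≠ 0) : s • a + t • b ≠ 0 := fun e => by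
  obtain ⟨rfl, rfl⟩ := LinearIndependent.pair_iff.1 hab s t e
  simp at h

theorem linearIndependent_pair_neg (hab : LinearIndependent ℝ ![a, b]) :
    LinearIndependent ℝ ![a, -b] := by
  rw [LinearIndependent.pair_iff] at hab ⊢
  intro s t h
  have := hab s (-t) (by rw [← h]; module)
  exact ⟨this.1, neg_eq_zero.1 this.2⟩

theorem arc_nonempty (hab : LinearIndependent ℝ ![a, b]) : (arc a b).Nonempty :=
  ⟨_, 1, 1, one_pos, one_pos, smul_add_smul_ne_zero hab (Or.inl one_ne_zero), rfl⟩

theorem isPreconnected_arc (hab : LinearIndependent ℝ ![a, b]) : IsPreconnected (arc a b) := by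
  let S : Set (ℝ × ℝ) := Set.Ioi 0 ×ˢ Set.Ioi 0
  have hS : IsPreconnected S := isPreconnected_Ioi.prod isPreconnected_Ioi
  have : PreconnectedSpace S := Subtype.preconnectedSpace hS
  let g : S → RP d := fun x => mk' ℝ ⟨x.1.1 • a + x.1.2 • b,
    smul_add_smul_ne_zero hab (Or.inl (ne_of_gt x.2.1))⟩
  have hg : Continuous g := continuous_mk'.comp (Continuous.subtype_mk (by fun_prop) _)
  have e : arc a b = Set.range g := by
    ext p
    constructor
    · rintro ⟨s, t, hs, ht, h, rfl⟩
      exact ⟨⟨(s, t), hs, ht⟩, rfl⟩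
    · rintro ⟨x, rfl⟩
      exact ⟨x.1.1, x.1.2, x.2.1, x.2.2, _, rfl⟩
  rw [e]
  exact isPreconnected_range hg

theorem exists_dual_eq_one_eq_zero (hab : LinearIndependent ℝ ![a, b]) :
    ∃ g : Dual ℝ (Fin (d + 1) → ℝ), g a = 1 ∧ g b = 0 := by
  have h : a ∉ Submodule.span ℝ {b} := by
    rw [Submodule.mem_span_singleton]
    rintro ⟨c, hc⟩
    exact smul_add_smul_ne_zero hab (s := 1) (t := -c) (Or.inl one_ne_zero)
      (by rw [← hc]; module)
  obtain ⟨f, hf, hle⟩ := Submodule.exists_le_ker_of_notMem h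
  refine ⟨(f a)⁻¹ • f, by simp [hf], ?_⟩
  have : f b = 0 := hle (Submodule.mem_span_singleton_self b)
  simp [this]

/-- Coordinates with respect to two linearly independent vectors. -/
theorem exists_dual_pair (hab : LinearIndependent ℝ ![a, b]) :
    ∃ g h : Dual ℝ (Fin (d + 1) → ℝ),
      ∀ s t : ℝ, g (s • a + t • b) = s ∧ h (s • a + t • b) = t := by
  obtain ⟨g, ga, gb⟩ := exists_dual_eq_one_eq_zero hab
  obtain ⟨h, hb, ha⟩ := exists_dual_eq_one_eq_zero (a := b) (b := a)
    (LinearIndependent.pair_symm_iff.1 hab)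
  exact ⟨g, h, fun s t => by simp [ga, gb, ha, hb]⟩

/-- The points at which the product of two functionals is positive. -/
def positiveLocus (g h : Dual ℝ (Fin (d + 1) → ℝ)) : Set (RP d) :=
  {p | 0 < g p.rep * h p.rep}

/-- The product is homogeneous of degree two, so rescaling multiplies it by a positive square. -/
theorem mk_mem_positiveLocus {g h : Dual ℝ (Fin (d + 1) → ℝ)} {u : Fin (d + 1) → ℝ}
    (hu : u ≠ 0) : mk ℝ u hu ∈ positiveLocus g h ↔ 0 < g u * h u := by
  obtain ⟨c, hc⟩ := exists_smul_eq_mk_rep ℝ u hu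
  rw [positiveLocus, Set.mem_ofPred_eq, ← hc, Units.smul_def, map_smul, map_smul, smul_eq_mul,
    smul_eq_mul]
  have : 0 < (c : ℝ) ^ 2 := by have := c.ne_zero; positivity
  rw [show (c : ℝ) * g u * (c * h u) = (c : ℝ) ^ 2 * (g u * h u) by ring]
  exact mul_pos_iff_of_pos_left this

theorem isOpen_positiveLocus (g h : Dual ℝ (Fin (d + 1) → ℝ)) : IsOpen (positiveLocus g h) := by
  rw [← isQuotientMap_mk'.isOpen_preimage]
  have : mk' ℝ ⁻¹' positiveLocus g h =
      {u : {v : Fin (d + 1) → ℝ // v ≠ 0} | 0 < g u.1 * h u.1} := by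
    ext u
    exact mk_mem_positiveLocus u.2
  rw [this]
  have hg := g.continuous_of_finiteDimensional
  have hh := h.continuous_of_finiteDimensional
  exact isOpen_lt continuous_const (by fun_prop)

/-- The coordinate functionals separate the two arcs by disjoint open sets, where their product is
positive or negative. -/
theorem connectedComponentIn_arc_union (hab : LinearIndependent ℝ ![a, b]) {p : RP d}
    (hp : p ∈ arc a b) : connectedComponentIn (arc a b ∪ arc a (-b)) p = arc a b := by
  apply Set.Subset.antisymm
  · obtain ⟨g, h, hgh⟩ := exists_dual_pair hab
    have h1 : arc a b ⊆ positiveLocus g h := by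
      rintro q ⟨s, t, hs, ht, hne, rfl⟩
      rw [mk_mem_positiveLocus, (hgh s t).1, (hgh s t).2]
      positivity
    have h2 : arc a (-b) ⊆ positiveLocus g (-h) := by
      intro q
      induction q using Projectivization.ind with
      | h u hu =>
        rw [mk_mem_arc_neg_iff, mk_mem_positiveLocus]
        rintro ⟨s, t, hst, rfl⟩
        rw [LinearMap.neg_apply, (hgh s t).1, (hgh s t).2]
        linarith
    have hdis : Disjoint (positiveLocus g h) (positiveLocus g (-h)) := by
      rw [Set.disjoint_left]
      intro q
      simp only [positiveLocus, Set.mem_ofPred_eq, LinearMap.neg_apply]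
      intro _ _
      linarith
    have hsub := isPreconnected_connectedComponentIn.subset_left_of_subset_union
      (isOpen_positiveLocus g h) (isOpen_positiveLocus g (-h)) hdis
      ((connectedComponentIn_subset (arc a b ∪ arc a (-b)) p).trans (Set.union_subset_union h1 h2))
      ⟨p, mem_connectedComponentIn (Or.inl hp), h1 hp⟩
    intro q hq
    exact (connectedComponentIn_subset _ _ hq).resolve_right fun hq' =>
      Set.disjoint_left.1 hdis (hsub hq) (h2 hq')
  · exact (isPreconnected_arc hab).subset_connectedComponentIn hp Set.subset_union_left

theorem isComponentOf_arc_union_iff (hab : LinearIndependent ℝ ![a, b]) (C : Set (RP d)) :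
    IsComponentOf C (arc a b ∪ arc a (-b)) ↔ C = arc a b ∨ C = arc a (-b) := by
  have hab' := linearIndependent_pair_neg hab
  have h1 := fun p (hp : p ∈ arc a b) => connectedComponentIn_arc_union hab hp
  have h2 : ∀ p ∈ arc a (-b), connectedComponentIn (arc a b ∪ arc a (-b)) p = arc a (-b) := by
    intro p hp
    have := connectedComponentIn_arc_union hab' hp
    rwa [neg_neg, Set.union_comm] at this
  constructor
  · rintro ⟨p, hp | hp, rfl⟩
    · exact Or.inl (h1 p hp)
    · exact Or.inr (h2 p hp)
  · rintro (rfl | rfl)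
    · obtain ⟨p, hp⟩ := arc_nonempty hab
      exact ⟨p, Or.inl hp, (h1 p hp).symm⟩
    · obtain ⟨p, hp⟩ := arc_nonempty hab'
      exact ⟨p, Or.inr hp, (h2 p hp).symm⟩

/-- A closed projective segment lifts continuously to the segment between the vectors. -/
theorem exists_continuousAt_lift (hab : LinearIndependent ℝ ![a, b]) :
    ∃ L : RP d → Fin (d + 1) → ℝ, ∀ s t : ℝ, s + t = 1 → ∀ h : s • a + t • b ≠ 0,
      ContinuousAt L (mk ℝ (s • a + t • b) h) ∧ L (mk ℝ (s • a + t • b) h) = s • a + t • b := by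
  obtain ⟨g, h, hgh⟩ := exists_dual_pair hab
  -- Rescales the coordinates to have sum 1. This is homogeneous of degree zero and so descends to
  -- projective space; continuity is only needed where the sum is nonzero, which is the set `O`.
  let L' : {v : Fin (d + 1) → ℝ // v ≠ 0} → Fin (d + 1) → ℝ := fun u =>
    (g u.1 / (g u.1 + h u.1)) • a + (h u.1 / (g u.1 + h u.1)) • b
  have hL' : ∀ (u v : {v : Fin (d + 1) → ℝ // v ≠ 0}) (c : ℝ), u = c • (v : Fin (d + 1) → ℝ) →
      L' u = L' v := by
    rintro ⟨u, hu⟩ ⟨v, hv⟩ c rfl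
    have hc : c ≠ 0 := by rintro rfl; simp at hu
    simp only [L', map_smul, smul_eq_mul, ← mul_add, mul_div_mul_left _ _ hc]
  let O : Set (RP d) := positiveLocus (g + h) (g + h)
  have hg := g.continuous_of_finiteDimensional
  have hh := h.continuous_of_finiteDimensional
  have hcont : ContinuousOn (Projectivization.lift L' hL') O := by
    rw [isQuotientMap_mk'.continuousOn_isOpen_iff (isOpen_positiveLocus _ _)]
    have e : Projectivization.lift L' hL' ∘ mk' ℝ = L' := rfl
    rw [e]
    have hne : ∀ u ∈ mk' ℝ ⁻¹' O, g u.1 + h u.1 ≠ 0 := by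
      intro u hu h0
      have := (mk_mem_positiveLocus u.2).1 hu
      simp [h0] at this
    apply ContinuousOn.add
    · exact ContinuousOn.smul (ContinuousOn.div (by fun_prop) (by fun_prop) hne) (by fun_prop)
    · exact ContinuousOn.smul (ContinuousOn.div (by fun_prop) (by fun_prop) hne) (by fun_prop)
  refine ⟨Projectivization.lift L' hL', fun s t hst hne => ⟨?_, ?_⟩⟩
  · refine hcont.continuousAt ((isOpen_positiveLocus _ _).mem_nhds ?_)
    rw [mk_mem_positiveLocus, LinearMap.add_apply, (hgh s t).1, (hgh s t).2, hst]
    norm_num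
  · rw [Projectivization.lift_mk]
    simp only [L', (hgh s t).1, (hgh s t).2, hst, div_one]

end Arcs

/-! ### Crossings and the selected components -/

section Configuration

variable {n d : ℕ} {P : Fin n → RP d} {v : Fin n → Fin (d + 1) → ℝ}
  {φ : Finset (Fin n) → Dual ℝ (Fin (d + 1) → ℝ)}

theorem Represents.puncturedLine_eq (hv : Represents v P) {i j : Fin n}
    (hij : LinearIndependent ℝ ![v i, v j]) :
    puncturedLine P i j = arc (v i) (v j) ∪ arc (v i) (-v j) := by
  ext p
  induction p using Projectivization.ind with
  | h u hu =>
    obtain ⟨hi, ei⟩ := hv i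
    obtain ⟨hj, ej⟩ := hv j
    rw [Set.mem_union, mk_mem_arc_iff, mk_mem_arc_neg_iff, puncturedLine, Set.mem_sdiff,
      SetLike.mem_coe, ← Set.image_pair, ← Projectivization.Subspace.mem_submodule_iff,
      hv.submodule_span, Set.image_pair, Set.image_pair, Submodule.mem_span_pair, Set.mem_insert_iff,
      Set.mem_singleton_iff, ← ei, ← ej, mk_eq_mk_iff', mk_eq_mk_iff', not_or]
    constructor
    · rintro ⟨⟨s, t, rfl⟩, h1, h2⟩
      have hs : s ≠ 0 := by rintro rfl; exact h2 ⟨t, by simp⟩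
      have ht : t ≠ 0 := by rintro rfl; exact h1 ⟨s, by simp⟩
      rcases (mul_ne_zero hs ht).lt_or_gt with h | h
      · exact Or.inr ⟨s, t, h, rfl⟩
      · exact Or.inl ⟨s, t, h, rfl⟩
    · intro h
      obtain ⟨s, t, hst, rfl⟩ : ∃ s t : ℝ, s * t ≠ 0 ∧ u = s • v i + t • v j := by
        rcases h with ⟨s, t, h, e⟩ | ⟨s, t, h, e⟩
        · exact ⟨s, t, h.ne', e⟩
        · exact ⟨s, t, h.ne, e⟩
      obtain ⟨hs, ht⟩ := mul_ne_zero_iff.1 hst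
      refine ⟨⟨s, t, rfl⟩, ?_, ?_⟩
      · rintro ⟨c, hc⟩
        exact smul_add_smul_ne_zero hij (s := s - c) (Or.inr ht)
          (by rw [sub_smul, hc]; module)
      · rintro ⟨c, hc⟩
        exact smul_add_smul_ne_zero hij (t := t - c) (Or.inl hs)
          (by rw [sub_smul, hc]; module)

/-- A positive combination of two reals, the first nonzero, can vanish only if they have opposite
signs; then swapping their absolute values provides the weights. -/
theorem IsHyperplaneSystem.inter_arc_nonempty_iff (hφ : IsHyperplaneSystem P φ)
    {s : Finset (Fin n)} (hs : s.card = d) {a b : Fin (d + 1) → ℝ}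
    (hab : LinearIndependent ℝ ![a, b]) (ha : φ s a ≠ 0) :
    ((Projectivization.Subspace.span (P '' s) : Set (RP d)) ∩ arc a b).Nonempty ↔
      φ s a * φ s b < 0 := by
  constructor
  · rintro ⟨_, hp, x, y, hx, hy, hne, rfl⟩
    rw [SetLike.mem_coe, ← Projectivization.Subspace.mem_submodule_iff, ← hφ s hs, map_add,
      map_smul, map_smul, smul_eq_mul, smul_eq_mul] at hp
    have h1 : 0 < φ s a ^ 2 := by positivity
    have h2 : y * (φ s a * φ s b) = -(x * φ s a ^ 2) := by linear_combination φ s a * hp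
    by_contra hcon
    have := mul_nonneg hy.le (not_lt.1 hcon)
    have := mul_pos hx h1
    linarith
  · intro h
    have key : ∀ x y : ℝ, 0 < x → 0 < y → x * φ s a + y * φ s b = 0 →
        ((Projectivization.Subspace.span (P '' s) : Set (RP d)) ∩ arc a b).Nonempty := by
      intro x y hx hy e
      have hne := smul_add_smul_ne_zero hab (s := x) (t := y) (Or.inl hx.ne')
      refine ⟨mk ℝ _ hne, ?_, x, y, hx, hy, hne, rfl⟩
      rw [SetLike.mem_coe, ← Projectivization.Subspace.mem_submodule_iff, ← hφ s hs, map_add,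
        map_smul, map_smul, smul_eq_mul, smul_eq_mul, e]
    rcases mul_neg_iff.1 h with ⟨h1, h2⟩ | ⟨h1, h2⟩
    · exact key (-φ s b) (φ s a) (by linarith) h1 (by ring)
    · exact key (φ s b) (-φ s a) h2 (by linarith) (by ring)

/-- Genericity lets the index set be recovered from its hyperplane, so counting hyperplanes is the
same as counting index sets. -/
theorem IsHyperplaneSystem.crossingNumber_arc (hφ : IsHyperplaneSystem P φ) (hP : IsGeneric P)
    {i j : Fin n} {a b : Fin (d + 1) → ℝ} (hab : LinearIndependent ℝ ![a, b])
    (ha : ∀ s ∈ avoidingSets n d i j, φ s a ≠ 0) :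
    crossingNumber P i j (arc a b) = separatingCount φ i j a b := by
  have e : {H ∈ spannedHyperplanes P i j | ((H : Set (RP d)) ∩ arc a b).Nonempty} =
      (fun s : Finset (Fin n) => Projectivization.Subspace.span (P '' s)) ''
        ((avoidingSets n d i j).filter fun s => φ s a * φ s b < 0 : Finset (Finset (Fin n))) := by
    ext H
    simp only [spannedHyperplanes, Set.mem_ofPred_eq, Set.mem_image, Finset.coe_filter]
    constructor
    · rintro ⟨⟨s, hs, hi, hj, rfl⟩, hne⟩
      have hm : s ∈ avoidingSets n d i j := mem_avoidingSets.2 ⟨hs, hi, hj⟩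
      exact ⟨s, ⟨hm, (hφ.inter_arc_nonempty_iff hs hab (ha s hm)).1 hne⟩, rfl⟩
    · rintro ⟨s, ⟨hm, hlt⟩, rfl⟩
      obtain ⟨hs, hi, hj⟩ := mem_avoidingSets.1 hm
      exact ⟨⟨s, hs, hi, hj, rfl⟩, (hφ.inter_arc_nonempty_iff hs hab (ha s hm)).2 hlt⟩
  rw [crossingNumber, e, Set.InjOn.ncard_image, Set.ncard_coe_finset, separatingCount]
  intro s hs t ht hst
  simp only [Finset.coe_filter, Set.mem_ofPred_eq] at hs ht hst
  ext k
  rw [← hP.mem_span_iff (mem_avoidingSets.1 hs.1).1, hst,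
    hP.mem_span_iff (mem_avoidingSets.1 ht.1).1]

/-- For suitable representatives, the selected components are the positive arcs. -/
theorem IsGeneric.exists_represents_isOrchardArc (hP : IsGeneric P) (hd : 1 ≤ d)
    (hodd : Odd ((n - 2).choose d)) :
    ∃ w, Represents w P ∧
      ∀ i j, i ≠ j → ∀ C, IsOrchardArc P i j C ↔ C = arc (w i) (w j) := by
  obtain ⟨φ, hφ⟩ := hP.exists_isHyperplaneSystem
  obtain ⟨w, hw, hcount⟩ := exists_represents_separatingCount hφ hP hd hodd
  refine ⟨w, hw, fun i j hij C => ?_⟩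
  have hlin := hP.linearIndependent_pair hw hd hij
  have hi : ∀ s ∈ avoidingSets n d i j, φ s (w i) ≠ 0 := fun s hs => by
    obtain ⟨hs, hi, -⟩ := mem_avoidingSets.1 hs
    rwa [Ne, hφ.apply_eq_zero hP hw hs]
  have h1 := hφ.crossingNumber_arc hP hlin hi
  have h2 := hφ.crossingNumber_arc hP (linearIndependent_pair_neg hlin) hi
  rw [IsOrchardArc, hw.puncturedLine_eq hlin, isComponentOf_arc_union_iff hlin,
    ← ZMod.natCast_eq_natCast_iff]
  constructor
  · rintro ⟨rfl | rfl, h⟩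
    · rfl
    · exfalso
      have h3 := congrArg (Nat.cast (R := ZMod 2)) (separatingCount_add_neg hφ hP hw hij)
      rw [ZMod.natCast_eq_one_iff_odd.2 hodd] at h3
      push_cast at h3
      rw [hcount i j hij, ← h2, h] at h3
      have aux : ∀ x : ZMod 2, x + x ≠ 1 := by decide
      exact aux _ h3
  · rintro rfl
    exact ⟨Or.inl rfl, by rw [h1, hcount i j hij]⟩

end Configuration

/-! ### Edges and barycentric coordinates of the complete graph -/

section Graph

variable {n : ℕ}

theorem CompleteGraphSpace.continuous_coord (k : Fin n) :
    Continuous fun x : CompleteGraphSpace n => x.1 k :=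
  (continuous_apply k).comp continuous_subtype_val

theorem CompleteGraphSpace.sum_eq_one (x : CompleteGraphSpace n) : ∑ k, x.1 k = 1 := x.2.1.2

theorem CompleteGraphSpace.nonneg (x : CompleteGraphSpace n) (k : Fin n) : 0 ≤ x.1 k := x.2.1.1 k

/-- The closed edge between two vertices. -/
def closedEdge (i j : Fin n) : Set (CompleteGraphSpace n) :=
  {x | Function.support x.1 ⊆ {i, j}}

theorem mem_closedEdge {i j : Fin n} {x : CompleteGraphSpace n} :
    x ∈ closedEdge i j ↔ ∀ k, k ≠ i → k ≠ j → x.1 k = 0 := by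
  simp only [closedEdge, Set.mem_ofPred_eq, Function.support_subset_iff, Set.mem_insert_iff,
    Set.mem_singleton_iff]
  refine forall_congr' fun k => ?_
  tauto

theorem isClosed_closedEdge (i j : Fin n) : IsClosed (closedEdge i j) := by
  have : closedEdge i j = ⋂ k, {x | k ≠ i → k ≠ j → x.1 k = 0} := by
    ext x; simp [mem_closedEdge]
  rw [this]
  refine isClosed_iInter fun k => ?_
  by_cases hi : k = i
  · simp [hi]
  by_cases hj : k = j
  · simp [hj]
  simpa [hi, hj] using isClosed_eq (CompleteGraphSpace.continuous_coord k) continuous_const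

/-- Two positive coordinates already exhaust the bound on the support. -/
theorem openEdge_subset_closedEdge {i j : Fin n} (hij : i ≠ j) :
    openEdge i j ⊆ closedEdge i j := by
  rintro x ⟨hi, hj⟩
  have hsub : ({i, j} : Set (Fin n)) ⊆ Function.support x.1 := by
    rintro k (rfl | rfl)
    · exact hi.ne'
    · exact hj.ne'
  have := Set.eq_of_subset_of_ncard_le hsub (by rw [Set.ncard_pair hij]; exact x.2.2)
  exact this.ge

theorem sum_smul_of_mem_closedEdge {E : Type*} [AddCommGroup E] [Module ℝ E] (w : Fin n → E)
    {i j : Fin n} (hij : i ≠ j) {x : CompleteGraphSpace n} (hx : x ∈ closedEdge i j) :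
    ∑ k, x.1 k • w k = x.1 i • w i + x.1 j • w j :=
  Fintype.sum_eq_add i j hij fun k hk => by rw [mem_closedEdge.1 hx k hk.1 hk.2, zero_smul]

theorem add_eq_one_of_mem_closedEdge {i j : Fin n} (hij : i ≠ j) {x : CompleteGraphSpace n}
    (hx : x ∈ closedEdge i j) : x.1 i + x.1 j = 1 := by
  simpa [x.sum_eq_one] using (sum_smul_of_mem_closedEdge (fun _ => (1 : ℝ)) hij hx).symm

theorem exists_openEdge_coord {i j : Fin n} (hij : i ≠ j) {s t : ℝ} (hs : 0 < s) (ht : 0 < t)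
    (hst : s + t = 1) : ∃ x ∈ openEdge i j, x.1 i = s ∧ x.1 j = t := by
  let c : Fin n → ℝ := Pi.single i s + Pi.single j t
  have hi : c i = s := by simp [c, hij]
  have hj : c j = t := by simp [c, hij.symm]
  have hk : ∀ k, k ≠ i ∧ k ≠ j → c k = 0 := by rintro k ⟨h1, h2⟩; simp [c, h1, h2]
  have hsupp : Function.support c ⊆ {i, j} := by
    intro k hk'
    by_contra hcon
    simp only [Set.mem_insert_iff, Set.mem_singleton_iff, not_or] at hcon
    exact hk' (hk k hcon)
  refine ⟨⟨c, ⟨fun k => ?_, ?_⟩, ?_⟩, ⟨?_, ?_⟩, hi, hj⟩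
  · by_cases h1 : k = i
    · rw [h1, hi]; exact hs.le
    by_cases h2 : k = j
    · rw [h2, hj]; exact ht.le
    exact (hk k ⟨h1, h2⟩).ge
  · rw [Fintype.sum_eq_add i j hij hk, hi, hj, hst]
  · exact (Set.ncard_le_ncard hsupp).trans (Set.ncard_pair hij).le
  · exact hs.trans_eq hi.symm
  · exact ht.trans_eq hj.symm

theorem CompleteGraphSpace.exists_pos (x : CompleteGraphSpace n) : ∃ i, 0 < x.1 i := by
  by_contra! h
  have := Finset.sum_nonpos fun k (_ : k ∈ Finset.univ) => h k
  rw [x.sum_eq_one] at this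
  linarith

theorem CompleteGraphSpace.eq_vertex_or_mem_openEdge (x : CompleteGraphSpace n) :
    (∃ i, x = vertex i) ∨ ∃ i j, i ≠ j ∧ x ∈ openEdge i j := by
  obtain ⟨i, hi⟩ := x.exists_pos
  by_cases h : ∃ j, i ≠ j ∧ 0 < x.1 j
  · obtain ⟨j, hij, hj⟩ := h
    exact Or.inr ⟨i, j, hij, hi, hj⟩
  · push Not at h
    have h0 : ∀ k, k ≠ i → x.1 k = 0 := fun k hk => (h k hk.symm).antisymm (x.nonneg k)
    have h1 : x.1 i = 1 := by rw [← x.sum_eq_one, Fintype.sum_eq_single i h0]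
    refine Or.inl ⟨i, Subtype.ext (funext fun k => ?_)⟩
    by_cases hk : k = i
    · subst hk; simp [vertex, h1]
    · simp [vertex, h0 k hk, hk]

theorem CompleteGraphSpace.exists_mem_closedEdge (hn : 2 ≤ n) (x : CompleteGraphSpace n) :
    ∃ i j, i ≠ j ∧ x ∈ closedEdge i j := by
  rcases x.eq_vertex_or_mem_openEdge with ⟨i, rfl⟩ | ⟨i, j, hij, hx⟩
  · have : Nontrivial (Fin n) := Fin.nontrivial_iff_two_le.2 hn
    obtain ⟨j, hj⟩ := exists_ne i
    exact ⟨i, j, hj.symm, mem_closedEdge.2 fun k hk _ => by simp [vertex, hk]⟩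
  · exact ⟨i, j, hij, openEdge_subset_closedEdge hij hx⟩

/-- The linear extension of a map from the vertices. -/
def linearExtension {d : ℕ} (w : Fin n → Fin (d + 1) → ℝ) (x : CompleteGraphSpace n) :
    Fin (d + 1) → ℝ :=
  ∑ k, x.1 k • w k

theorem continuous_linearExtension {d : ℕ} (w : Fin n → Fin (d + 1) → ℝ) :
    Continuous (linearExtension w) :=
  continuous_finsetSum _ fun k _ => (CompleteGraphSpace.continuous_coord k).smul continuous_const

theorem linearExtension_vertex {d : ℕ} (w : Fin n → Fin (d + 1) → ℝ) (i : Fin n) :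
    linearExtension w (vertex i) = w i := by
  rw [linearExtension, Fintype.sum_eq_single i]
  · simp [vertex]
  · intro k hk; simp [vertex, hk]

end Graph

/-! ### Existence of the immersion -/

section Immersion

variable {n d : ℕ} {P : Fin n → RP d} {w : Fin n → Fin (d + 1) → ℝ}

theorem IsGeneric.eq_zero_of_sum_smul (hP : IsGeneric P) (hw : Represents w P) {c : Fin n → ℝ}
    (hc : (Function.support c).ncard ≤ d + 1) (h : ∑ k, c k • w k = 0) : c = 0 := by
  classical
  have hfin := Set.toFinite (Function.support c)
  have hlin := hP.linearIndepOn hw (s := hfin.toFinset)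
    (by rwa [← Set.ncard_eq_toFinset_card _ hfin])
  rw [linearIndepOn_finset_iff] at hlin
  have hz := hlin c (by
    rw [← h]
    refine Finset.sum_subset (Finset.subset_univ _) fun k _ hk => ?_
    rw [Set.Finite.mem_toFinset, Function.notMem_support] at hk
    rw [hk, zero_smul])
  ext k
  by_contra hk
  exact hk (hz k (hfin.mem_toFinset.2 hk))

theorem IsGeneric.linearExtension_ne_zero (hP : IsGeneric P) (hw : Represents w P) (hd : 1 ≤ d)
    (x : CompleteGraphSpace n) : linearExtension w x ≠ 0 := fun h => by
  have h0 := hP.eq_zero_of_sum_smul hw (x.2.2.trans (by omega)) h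
  have := x.sum_eq_one
  simp [h0] at this

/-- The projectivization of the linear extension of representatives. -/
noncomputable def projectiveExtension (w : Fin n → Fin (d + 1) → ℝ) (h : ∀ x, linearExtension w x ≠ 0) :
    C(CompleteGraphSpace n, RP d) where
  toFun x := mk' ℝ ⟨linearExtension w x, h x⟩
  continuous_toFun := continuous_mk'.comp ((continuous_linearExtension w).subtype_mk h)

/-- The supports of two points in the open star of `i` share `i`, so their union has at most three
elements. Since `3 ≤ d + 1`, the vectors involved are independent and the coordinates are
proportional; having sum 1, they agree. -/
theorem IsGeneric.injOn_projectiveExtension (hP : IsGeneric P) (hw : Represents w P) (hd : 2 ≤ d)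
    (h : ∀ x, linearExtension w x ≠ 0) (i : Fin n) :
    Set.InjOn (projectiveExtension w h) {x | 0 < x.1 i} := by
  intro x hx y hy hxy
  obtain ⟨c, hc⟩ := (mk_eq_mk_iff' ℝ _ _ (h x) (h y)).1 hxy
  have hsub : Function.support (x.1 - c • y.1) ⊆ Function.support x.1 ∪ Function.support y.1 := by
    intro k hk
    by_contra hcon
    simp only [Set.mem_union, Function.mem_support, not_or, not_not] at hcon
    simp [hcon.1, hcon.2] at hk
  have hinter : 1 ≤ (Function.support x.1 ∩ Function.support y.1).ncard := by
    rw [Nat.one_le_iff_ne_zero, Ne, Set.ncard_eq_zero]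
    exact Set.Nonempty.ne_empty ⟨i, ne_of_gt hx, ne_of_gt hy⟩
  have hcard := Set.ncard_union_add_ncard_inter (Function.support x.1) (Function.support y.1)
  have hx2 := x.2.2
  have hy2 := y.2.2
  have hz := hP.eq_zero_of_sum_smul hw (c := x.1 - c • y.1)
    ((Set.ncard_le_ncard hsub).trans (by omega)) (by
      simp only [Pi.sub_apply, Pi.smul_apply, smul_eq_mul, sub_smul, mul_smul,
        Finset.sum_sub_distrib, ← Finset.smul_sum]
      exact sub_eq_zero.2 hc.symm)
  have hxc : x.1 = c • y.1 := sub_eq_zero.1 hz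
  have hc1 : c = 1 := by
    have := x.sum_eq_one
    rw [hxc] at this
    simpa [← Finset.mul_sum, y.sum_eq_one] using this
  exact Subtype.ext (by rw [hxc, hc1, one_smul])

theorem IsGeneric.bijOn_projectiveExtension (hP : IsGeneric P) (hw : Represents w P) (hd : 2 ≤ d)
    (h : ∀ x, linearExtension w x ≠ 0) {i j : Fin n} (hij : i ≠ j) :
    Set.BijOn (projectiveExtension w h) (openEdge i j) (arc (w i) (w j)) := by
  refine ⟨?_, (hP.injOn_projectiveExtension hw hd h i).mono fun x hx => hx.1, ?_⟩
  · intro x hx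
    exact (mk_mem_arc_iff (h x)).2 ⟨x.1 i, x.1 j, mul_pos hx.1 hx.2,
      sum_smul_of_mem_closedEdge w hij (openEdge_subset_closedEdge hij hx)⟩
  · rintro _ ⟨s, t, hs, ht, hne, rfl⟩
    obtain ⟨x, hx, hxi, hxj⟩ := exists_openEdge_coord hij (s := s / (s + t)) (t := t / (s + t))
      (by positivity) (by positivity) (by field_simp)
    refine ⟨x, hx, (mk_eq_mk_iff' ℝ _ _ (h x) hne).2 ⟨(s + t)⁻¹, ?_⟩⟩
    rw [linearExtension, sum_smul_of_mem_closedEdge w hij (openEdge_subset_closedEdge hij hx), hxi,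
      hxj]
    module

theorem IsGeneric.isOrchardImmersion_projectiveExtension (hP : IsGeneric P) (hw : Represents w P)
    (hd : 2 ≤ d) (harc : ∀ i j, i ≠ j → ∀ C, IsOrchardArc P i j C ↔ C = arc (w i) (w j))
    (h : ∀ x, linearExtension w x ≠ 0) : IsOrchardImmersion P (projectiveExtension w h) where
  map_vertex i := by
    obtain ⟨hi, ei⟩ := hw i
    rw [← ei]
    exact (mk_eq_mk_iff' ℝ _ _ (h _) hi).2 ⟨1, by rw [linearExtension_vertex, one_smul]⟩
  map_edge i j hij :=
    ⟨_, (harc i j hij _).2 rfl, hP.bijOn_projectiveExtension hw hd h hij⟩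
  locally_injective x := by
    obtain ⟨i, hi⟩ := x.exists_pos
    exact ⟨_, (isOpen_lt continuous_const (CompleteGraphSpace.continuous_coord i)).mem_nhds hi,
      hP.injOn_projectiveExtension hw hd h i⟩

end Immersion

/-! ### Lifting an arbitrary orchard immersion -/

section Lift

variable {n d : ℕ} {P : Fin n → RP d} {w : Fin n → Fin (d + 1) → ℝ}

/-- An orchard immersion agrees with the projective extension up to a self-map of the graph that
preserves all edges. -/
theorem IsOrchardImmersion.exists_reparametrization {f : C(CompleteGraphSpace n, RP d)}
    (hf : IsOrchardImmersion P f) (hw : Represents w P)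
    (harc : ∀ i j, i ≠ j → ∀ C, IsOrchardArc P i j C ↔ C = arc (w i) (w j))
    (h : ∀ x, linearExtension w x ≠ 0) (x : CompleteGraphSpace n) :
    ∃ y : CompleteGraphSpace n,
      Projectivization.mk ℝ (linearExtension w y) (h y) = f x ∧
      Function.support y.1 ⊆ Function.support x.1 := by
  rcases x.eq_vertex_or_mem_openEdge with ⟨i, rfl⟩ | ⟨i, j, hij, hx⟩
  · obtain ⟨hi, ei⟩ := hw i
    refine ⟨vertex i, ?_, subset_rfl⟩
    rw [hf.map_vertex, ← ei]
    exact (mk_eq_mk_iff' ℝ _ _ (h _) hi).2 ⟨1, by rw [linearExtension_vertex, one_smul]⟩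
  · obtain ⟨C, hC, hbij⟩ := hf.map_edge i j hij
    rw [(harc i j hij C).1 hC] at hbij
    obtain ⟨s, t, hs, ht, hne, e⟩ := hbij.mapsTo hx
    obtain ⟨y, hy, hyi, hyj⟩ := exists_openEdge_coord hij (s := s / (s + t)) (t := t / (s + t))
      (by positivity) (by positivity) (by field_simp)
    refine ⟨y, ?_, ?_⟩
    · rw [← e]
      refine (mk_eq_mk_iff' ℝ _ _ (h y) hne).2 ⟨(s + t)⁻¹, ?_⟩
      rw [linearExtension, sum_smul_of_mem_closedEdge w hij (openEdge_subset_closedEdge hij hy),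
        hyi, hyj]
      module
    · refine (openEdge_subset_closedEdge hij hy : Function.support y.1 ⊆ {i, j}).trans ?_
      rintro k (rfl | rfl)
      · exact hx.1.ne'
      · exact hx.2.ne'

/-- An orchard immersion lifts to a continuous map to the vector space that maps each edge to the
span of the vectors at its ends. -/
theorem IsOrchardImmersion.exists_lift {f : C(CompleteGraphSpace n, RP d)}
    (hf : IsOrchardImmersion P f) (hP : IsGeneric P) (hw : Represents w P) (hd : 1 ≤ d)
    (hn : 2 ≤ n) (harc : ∀ i j, i ≠ j → ∀ C, IsOrchardArc P i j C ↔ C = arc (w i) (w j)) :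
    ∃ F : C(CompleteGraphSpace n, Fin (d + 1) → ℝ),
      (∀ x, ∃ i j, F x ∈ Submodule.span ℝ {w i, w j}) ∧
        ∀ x, ∃ h : F x ≠ 0, Projectivization.mk ℝ (F x) h = f x := by
  have hne := hP.linearExtension_ne_zero hw hd
  choose y hy hsupp using hf.exists_reparametrization hw harc hne
  have hedge : ∀ i j x, x ∈ closedEdge i j → y x ∈ closedEdge i j :=
    fun i j x hx => (hsupp x).trans hx
  have hcont : Continuous fun x => linearExtension w (y x) := by
    let E : {p : Fin n × Fin n // p.1 ≠ p.2} → Set (CompleteGraphSpace n) :=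
      fun p => closedEdge p.1.1 p.1.2
    refine (locallyFinite_of_finite E).continuous ?_ (fun p => isClosed_closedEdge _ _) ?_
    · refine Set.eq_univ_of_forall fun x => Set.mem_iUnion.2 ?_
      obtain ⟨i, j, hij, hx⟩ := x.exists_mem_closedEdge hn
      exact ⟨⟨(i, j), hij⟩, hx⟩
    · rintro ⟨⟨i, j⟩, hij⟩
      obtain ⟨L, hL⟩ := exists_continuousAt_lift (hP.linearIndependent_pair hw hd hij)
      -- Although `y` was chosen pointwise, on a closed edge the lift equals `L ∘ f`, hence is
      -- continuous there. The finitely many closed edges cover the graph.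
      have key : ∀ x ∈ closedEdge i j, ContinuousAt L (f x) ∧
          L (f x) = linearExtension w (y x) := by
        intro x hx
        have hyx := hedge i j x hx
        have e : linearExtension w (y x) = (y x).1 i • w i + (y x).1 j • w j :=
          sum_smul_of_mem_closedEdge w hij hyx
        have h1 := hne (y x)
        have h2 := hy x
        rw [← h2]
        simp only [e] at h1 ⊢
        exact hL _ _ (add_eq_one_of_mem_closedEdge hij hyx) h1
      intro x hx
      have hx1 := (key x hx).1
      have : ContinuousAt (fun z => L (f z)) x :=
        ContinuousAt.comp (f := f) hx1 f.continuous.continuousAt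
      exact this.continuousWithinAt.congr (fun z hz => (key z hz).2.symm) (key x hx).2.symm
  refine ⟨⟨_, hcont⟩, fun x => ?_, fun x => ⟨hne (y x), hy x⟩⟩
  obtain ⟨i, j, hij, hx⟩ := x.exists_mem_closedEdge hn
  refine ⟨i, j, Submodule.mem_span_pair.2 ⟨(y x).1 i, (y x).1 j, ?_⟩⟩
  exact (sum_smul_of_mem_closedEdge w hij (hedge i j x hx)).symm

end Lift

/-! ### Factoring through a contractible space -/

section FundamentalGroup

theorem HomologicallyTrivial.of_comp {G X Y : Type*} [TopologicalSpace G] [TopologicalSpace X]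
    [TopologicalSpace Y] [SimplyConnectedSpace Y] (p : C(Y, X)) (F : C(G, Y)) :
    HomologicallyTrivial (p.comp F) := by
  intro x
  ext γ
  change Path.Homotopic.Quotient.map γ (p.comp F) = Path.Homotopic.Quotient.refl _
  rw [Path.Homotopic.Quotient.map_comp,
    Subsingleton.elim (Path.Homotopic.Quotient.map γ F) (Path.Homotopic.Quotient.refl _)]
  rfl

/-- The complement of the closed ray from the origin in the direction opposite to `u`. -/
def rayComplement {E : Type*} [AddCommGroup E] [Module ℝ E] (u : E) : Set E :=
  {y | ∀ c : ℝ, c ≤ 0 → y ≠ c • u}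

/-- The set is star-shaped about `u`: a segment from `u` that meets the removed ray must end on that
ray. -/
theorem contractibleSpace_rayComplement {E : Type*} [AddCommGroup E] [Module ℝ E]
    [TopologicalSpace E] [ContinuousAdd E] [ContinuousSMul ℝ E] {u : E} (hu : u ≠ 0) :
    ContractibleSpace (rayComplement u) := by
  have hmem : u ∈ rayComplement u := by
    intro c hc h
    have h1 : (1 - c) • u = 0 := by rw [sub_smul, one_smul, ← h, sub_self]
    rcases smul_eq_zero.1 h1 with h2 | h2
    · linarith
    · exact hu h2
  refine StarConvex.contractibleSpace (x := u) ?_ ⟨u, hmem⟩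
  intro y hy a b ha hb hab c hc h
  rcases hb.eq_or_lt with rfl | hb
  · rw [zero_smul, add_zero] at h
    refine hmem (c - a + 1) (by linarith) ?_
    rw [add_smul, sub_smul, ← h]
    simp
  · refine hy ((c - a) / b) (div_nonpos_of_nonpos_of_nonneg (by linarith) hb.le) ?_
    have h1 : b • y = (c - a) • u := by rw [sub_smul, ← h]; simp
    rw [div_eq_inv_mul, mul_smul, ← h1, smul_smul, inv_mul_cancel₀ hb.ne', one_smul]

/-- A real vector space is not a finite union of proper subspaces, and planes are proper because `2
< d + 1`. -/
theorem exists_forall_notMem_span_pair {n d : ℕ} (hd : 2 ≤ d) (w : Fin n → Fin (d + 1) → ℝ) :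
    ∃ u ≠ 0, ∀ i j, u ∉ Submodule.span ℝ {w i, w j} := by
  -- The extra subspace `⊥` ensures `u ≠ 0` even when there are no planes.
  let p : Option (Fin n × Fin n) → Submodule ℝ (Fin (d + 1) → ℝ) := fun o =>
    o.elim ⊥ fun q => Submodule.span ℝ {w q.1, w q.2}
  have hp : ∀ o, p o ≠ ⊤ := by
    intro o ho
    have h1 : finrank ℝ (p o) ≤ 2 := by
      rcases o with _ | q
      · exact (finrank_bot ℝ (Fin (d + 1) → ℝ)).le.trans (Nat.zero_le 2)
      · refine (finrank_span_le_card ({w q.1, w q.2} : Set (Fin (d + 1) → ℝ))).trans ?_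
        rw [Set.toFinset_insert, Set.toFinset_singleton]
        exact Finset.card_le_two
    rw [ho, finrank_top, Module.finrank_fin_fun] at h1
    omega
  have hcover : ⋃ o, (p o : Set (Fin (d + 1) → ℝ)) ≠ Set.univ := fun h => by
    obtain ⟨o, ho⟩ := Subspace.exists_eq_top_of_iUnion_eq_univ h
    exact hp o ho
  obtain ⟨u, hu⟩ := (Set.ne_univ_iff_exists_notMem _).1 hcover
  rw [Set.mem_iUnion, not_exists] at hu
  exact ⟨u, fun h => hu none h, fun i j => hu (some (i, j))⟩

/-- If the lift met the ray, it would do so at a nonzero multiple of `u`, placing `u` in one of the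
planes. -/
theorem homologicallyTrivial_of_lift {G : Type*} [TopologicalSpace G] {n d : ℕ} (hd : 2 ≤ d)
    (w : Fin n → Fin (d + 1) → ℝ) (f : C(G, RP d)) (F : C(G, Fin (d + 1) → ℝ))
    (hspan : ∀ x, ∃ i j, F x ∈ Submodule.span ℝ {w i, w j})
    (hF : ∀ x, ∃ h : F x ≠ 0, mk ℝ (F x) h = f x) : HomologicallyTrivial f := by
  obtain ⟨u, hu0, hu⟩ := exists_forall_notMem_span_pair hd w
  have := contractibleSpace_rayComplement hu0
  have hmem : ∀ x, F x ∈ rayComplement u := by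
    intro x c _ h
    obtain ⟨h0, -⟩ := hF x
    obtain ⟨i, j, hij⟩ := hspan x
    have hc : c ≠ 0 := by rintro rfl; exact h0 (by rw [h, zero_smul])
    rw [h] at hij
    exact hu i j ((Submodule.smul_mem_iff _ hc).1 hij)
  have hne : ∀ y ∈ rayComplement u, y ≠ 0 := fun y hy h => hy 0 le_rfl (by rw [h, zero_smul])
  let p : C(rayComplement u, RP d) :=
    ⟨fun y => mk' ℝ ⟨y.1, hne y.1 y.2⟩, continuous_mk'.comp (continuous_subtype_val.subtype_mk _)⟩
  let F' : C(G, rayComplement u) := ⟨fun x => ⟨F x, hmem x⟩, F.continuous.subtype_mk _⟩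
  have : f = p.comp F' := by
    ext x
    exact (hF x).2.symm
  rw [this]
  exact HomologicallyTrivial.of_comp p F'

end FundamentalGroup

end Orchard

theorem theorem4 (n d : ℕ) (hd : 2 ≤ d) (hodd : Odd ((n - 2).choose d))
    (P : Fin n → Orchard.RP d) (hP : Orchard.IsGeneric P) :
    (∀ i j, i ≠ j → ∃! C, Orchard.IsOrchardArc P i j C) ∧
      (∃ f, Orchard.IsOrchardImmersion P f) ∧
        ∀ f, Orchard.IsOrchardImmersion P f → Orchard.HomologicallyTrivial f := by
  obtain ⟨w, hw, harc⟩ := hP.exists_represents_isOrchardArc (by omega) hodd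
  -- For smaller `n` the truncated difference `n - 2` is 0, and `Nat.choose 0 d` is even because `d`
  -- is positive.
  have hn : 2 ≤ n := by
    by_contra h
    rw [Nat.choose_eq_zero_of_lt (by omega)] at hodd
    exact absurd hodd (by decide)
  refine ⟨fun i j hij => ⟨_, (harc i j hij _).2 rfl, fun C hC => (harc i j hij C).1 hC⟩,
    ⟨_, hP.isOrchardImmersion_projectiveExtension hw hd harc
      (hP.linearExtension_ne_zero hw (by omega))⟩, fun f hf => ?_⟩
  obtain ⟨F, hspan, hF⟩ := hf.exists_lift hP hw (by omega) hn harc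
  exact Orchard.homologicallyTrivial_of_lift hd w f F hspan hF
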